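/- Let $S$ be a Hausdorff semitopological $0$-bisimple inverse $\omega$-semigroup, i.e. an inverse semigroup with zero $0$, endowed with a Hausdorff topology in which all left and right translations are continuous, whose $\mathscr{D}$-classes are exactly $S\setminus\{0\}$ and $\{0\}$, and such that $E(S)\setminus\{0\}$ (the nonzero idempotents, ordered by $e\leqslant f\iff ef=fe=e$) is order isomorphic to $\{0,-1,-2,\ldots\}$ with the usual order. Then there exist a Hausdorff semitopological group $G$ (a group with a Hausdorff topology and separately continuous multiplication), a homomorphism $\theta\colon G\to G$, and a topology $\tau$ on $\mathbf{B}(G,\theta)^0=\mathbf{B}(G,\theta)\sqcup\{0\}$ such that $S$ is topologically isomorphic to $(\mathbf{B}(G,\theta)^0,\tau)$ and this space is a topological Bruck–Reilly extension of $G$ with adjoined zero in the class of Hausdorff semitopological semigroups. Here $\mathbf{B}(G,\theta)$ is the set $\mathbb{N}_0\times G\times\mathbb{N}_0$, where $\mathbb{N}_0=\{0,1,2,\ldots\}$, with the operation $$(i,s,j)(m,t,n)=\bigl(i+m-\min\{j,m\},\ \theta^{m-\min\{j,m\}}(s)\,\theta^{j-\min\{j,m\}}(t),\ j+n-\min\{j,m\}\bigr),$$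 and the last property means that $(\mathbf{B}(G,\theta)^0,\tau)$ is Hausdorff with separately continuous multiplication and that, for some $i\in\mathbb{N}_0$, the map $g\mapsto(i,g,i)$ is a topological isomorphism of $G$ onto the subsemigroup $\{(i,g,i):g\in G\}$ with the subspace topology (the adjoined zero is not required to be an isolated point of $\tau$). Moreover, if $S$ is locally compact, then $G$ is a locally compact topological group. -/

import Mathlib

universe u

open Topology

/-- A semigroup is *inverse* if every `x` has exactly one `y` with `xyx = x` and `yxy = y`. -/
def IsInverseSemigroup (S : Type u) [Semigroup S] : Prop :=
  ∀ x : S, ∃! y : S, x * y * x = x ∧ y * x * y = y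

/-- The principal left ideal `S¹a = {a} ∪ Sa`. -/
def principalLeftIdeal {S : Type u} [Semigroup S] (a : S) : Set S :=
  insert a (Set.range fun x : S => x * a)

/-- The principal right ideal `aS¹ = {a} ∪ aS`. -/
def principalRightIdeal {S : Type u} [Semigroup S] (a : S) : Set S :=
  insert a (Set.range fun x : S => a * x)

/-- Green's relation `𝓛`. -/
def GreenL {S : Type u} [Semigroup S] (a b : S) : Prop :=
  principalLeftIdeal a = principalLeftIdeal b

/-- Green's relation `𝓡`. -/
def GreenR {S : Type u} [Semigroup S] (a b : S) : Prop :=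
  principalRightIdeal a = principalRightIdeal b

/-- Green's relation `𝓓 = 𝓛 ∘ 𝓡`. -/
def GreenD {S : Type u} [Semigroup S] (a b : S) : Prop :=
  ∃ c : S, GreenL a c ∧ GreenR c b

/-- A *`0`-bisimple inverse `ω`-semigroup*: an inverse semigroup with zero whose `𝓓`-classes are
exactly `S ∖ {0}` and `{0}`, and whose nonzero idempotents, under the natural partial order
(`e ≤ f` iff `ef = fe = e`), are order isomorphic to `{0, -1, -2, …}`, that is, to `ℕ` with the
reversed order. -/
structure IsZeroBisimpleInverseOmegaSemigroup (S : Type u) [SemigroupWithZero S] : Prop where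
  inverse : IsInverseSemigroup S
  greenD_class_zero : {b : S | GreenD 0 b} = {0}
  greenD_class_of_ne_zero : ∀ a : S, a ≠ 0 → {b : S | GreenD a b} = {0}ᶜ
  omega_chain :
    Nonempty
      ((fun e f : {e : S // IsIdempotentElem e ∧ e ≠ 0} =>
          (e : S) * (f : S) = (e : S) ∧ (f : S) * (e : S) = (e : S)) ≃r
        ((· ≥ ·) : ℕ → ℕ → Prop))

/-- The underlying set `ℕ × G × ℕ` of the Bruck–Reilly extension `B(G, θ)` of a group `G` with
respect to an endomorphism `θ` of `G`. -/
@[ext]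
structure BruckReilly {G : Type u} [Group G] (θ : G →* G) : Type u where
  fst : ℕ
  mid : G
  snd : ℕ

namespace BruckReilly

variable {G : Type u} [Group G] {θ : G →* G}

/-- `(i, s, j) (m, t, n) =
(i + m - min {j, m}, θ^(m - min {j, m}) (s) θ^(j - min {j, m}) (t), j + n - min {j, m})`.
The subtractions are exact. -/
instance : Mul (BruckReilly θ) where
  mul x y :=
    ⟨x.fst + y.fst - min x.snd y.fst,
      θ^[y.fst - min x.snd y.fst] x.mid * θ^[x.snd - min x.snd y.fst] y.mid,
      x.snd + y.snd - min x.snd y.fst⟩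

theorem mul_def (x y : BruckReilly θ) :
    x * y =
      ⟨x.fst + y.fst - min x.snd y.fst,
        θ^[y.fst - min x.snd y.fst] x.mid * θ^[x.snd - min x.snd y.fst] y.mid,
        x.snd + y.snd - min x.snd y.fst⟩ :=
  rfl

instance : Semigroup (BruckReilly θ) where
  mul_assoc x y z := by
    obtain ⟨i, s, j⟩ := x
    obtain ⟨m, t, n⟩ := y
    obtain ⟨p, w, q⟩ := z
    simp only [mul_def, mk.injEq, iterate_map_mul, ← Function.iterate_add_apply, mul_assoc]
    have h₁ : p - min (j + n - min j m) p + (m - min j m) =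
        m + p - min n p - min j (m + p - min n p) := by omega
    have h₂ : p - min (j + n - min j m) p + (j - min j m) =
        j - min j (m + p - min n p) + (p - min n p) := by omega
    have h₃ : j + n - min j m - min (j + n - min j m) p =
        j - min j (m + p - min n p) + (n - min n p) := by omega
    rw [h₁, h₂, h₃]
    exact ⟨by omega, rfl, by omega⟩

end BruckReilly

/-- The space `B(G, θ)⁰` (the Bruck–Reilly extension with an adjoined zero), carrying some topology,
is a *topological Bruck–Reilly extension with adjoined zero of the semitopological group `G` in the
class of Hausdorff semitopological semigroups*: both `G` and `B(G, θ)⁰` are Hausdorff and have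
separately continuous multiplication, and for some `i` the map `g ↦ (i, g, i)` (which is always an
algebraic isomorphism of `G` onto `G_{i,i} = {(i, g, i) : g ∈ G}`) is a homeomorphism of `G` onto the
subspace `G_{i,i}` of `B(G, θ)⁰`. The topology is not restricted at zero in any other way; in
particular zero need not be isolated. -/
structure IsTopologicalBruckReillyExtensionWithZero {G : Type u} [Group G] [TopologicalSpace G]
    (θ : G →* G) [TopologicalSpace (WithZero (BruckReilly θ))] : Prop where
  t2_group : T2Space G
  separatelyContinuous_group : SeparatelyContinuousMul G
  t2_extension : T2Space (WithZero (BruckReilly θ))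
  separatelyContinuous_extension : SeparatelyContinuousMul (WithZero (BruckReilly θ))
  isEmbedding_diagonal :
    ∃ i : ℕ, IsEmbedding fun g : G => ((⟨i, g, i⟩ : BruckReilly θ) : WithZero (BruckReilly θ))

/-! The largest nonzero idempotent `e 0` is an identity, because every `x` is fixed by `xx⁻¹` on the
left and by `x⁻¹x` on the right. Since `1` and `e 1` are `𝓓`-related, there are `a`, `b` with `ab =
1` and `ba = e 1`. The map `x ↦ bxa` shifts the chain of idempotents by one, so `e n = b ^ n * a ^
n` (`exists_generatesIdempotents`).

Conjugation by a unit is an automorphism of this chain, hence trivial on it. So units commute with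
`ba`, and `θ u = aub` is an endomorphism of the group `G` of units. The rules `au = θ(u)a` and `ub =
bθ(u)` give the Bruck–Reilly product on the elements `b ^ i * g * a ^ j`, and these represent each
nonzero element exactly once.

The topology is transported along this bijection, and `G` carries the subspace topology. The units
form an open set, so `G` inherits local compactness, and Ellis' theorem makes it a topological
group. Ellis' theorem rests on a double-limit argument: a separately continuous function has small
oscillation on some strip, and translation moves the strip to `1`. -/

/-! ### Oscillation of separately continuous functions -/

section SeparateContinuity

open Filter Set

variable {X K : Type*} [TopologicalSpace X] [TopologicalSpace K]

/-- If `x ↦ f x` has oscillation greater than `ε` on every nonempty open set, then every nonempty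
open set has a point whose section separates by more than `ε / 4` two points of `K` that given
finitely many sections hardly separate. -/
theorem exists_pair_of_forall_lt_abs_sub [CompactSpace K] {f : X → K → ℝ}
    (hfX : ∀ y, Continuous fun x => f x y) (hfK : ∀ x, Continuous (f x)) {ε : ℝ} (hε : 0 < ε)
    (H : ∀ U : Set X, IsOpen U → U.Nonempty → ∃ x ∈ U, ∃ x' ∈ U, ∃ y, ε < |f x y - f x' y|)
    {δ : ℝ} (hδ : 0 < δ) (F : Finset X) {U : Set X} (hU : IsOpen U) (hne : U.Nonempty) :
    ∃ y y' : K, (∀ z ∈ F, |f z y - f z y'| ≤ δ) ∧ ∃ x ∈ U, ε / 4 < |f x y - f x y'| := by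
  by_contra! hc
  have hnhds : ∀ y : K, {y' | ∀ z ∈ F, |f z y - f z y'| ≤ δ} ∈ 𝓝 y := by
    intro y
    refine (Filter.eventually_all_finset F).2 fun z _ => ?_
    have : Tendsto (fun y' => |f z y - f z y'|) (𝓝 y) (𝓝 |f z y - f z y|) :=
      ((continuous_const.sub (hfK z)).abs).tendsto y
    rw [sub_self, abs_zero] at this
    exact this.eventually_le_const hδ
  obtain ⟨t, -, ht⟩ := isCompact_univ.elim_nhds_subcover _ fun y _ => hnhds y
  obtain ⟨x₀, hx₀⟩ := hne
  have hV : IsOpen {x | ∀ y ∈ t, |f x y - f x₀ y| < ε / 8} := by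
    simp only [ofPred_forall]
    exact t.finite_toSet.isOpen_biInter fun y _ =>
      isOpen_lt ((hfX y).sub continuous_const).abs continuous_const
  -- Comparing through a center `c` of the cover near `y` bounds the oscillation by `ε/4 + ε/8 + ε/8
  -- + ε/4 < ε`.
  obtain ⟨x, hx, x', hx', y, hy⟩ := H _ (hU.inter hV) ⟨x₀, hx₀, fun y _ => by simpa using hε⟩
  obtain ⟨c, hct, hcy⟩ := mem_iUnion₂.1 (ht (mem_univ y))
  have h₁ := abs_le.1 (hc c y hcy x hx.1)
  have h₂ := abs_le.1 (hc c y hcy x' hx'.1)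
  have h₃ := abs_lt.1 (hx.2 c hct)
  have h₄ := abs_lt.1 (hx'.2 c hct)
  exact hy.not_ge (abs_le.2 ⟨by linarith, by linarith⟩)

/-- A separately continuous function on the product of a locally compact Hausdorff space and a
compact space has, for each `ε > 0`, oscillation at most `ε` on some strip `U × K` with `U` open
and nonempty. -/
theorem exists_isOpen_forall_abs_sub_le [LocallyCompactSpace X] [T2Space X] [Nonempty X]
    [CompactSpace K] {f : X → K → ℝ} (hfX : ∀ y, Continuous fun x => f x y)
    (hfK : ∀ x, Continuous (f x)) {ε : ℝ} (hε : 0 < ε) :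
    ∃ U : Set X, IsOpen U ∧ U.Nonempty ∧ ∀ x ∈ U, ∀ x' ∈ U, ∀ y, |f x y - f x' y| ≤ ε := by
  by_contra! H
  -- The state is the finite set of earlier points and the current open set. The new pair is hardly
  -- separated by the earlier points, but clearly separated throughout the next open set.
  have step : ∀ (n : ℕ) (s : Finset X × {U : Set X // IsOpen U ∧ U.Nonempty}),
      ∃ (x : X) (V : {U : Set X // IsOpen U ∧ U.Nonempty}) (y y' : K), x ∈ V.1 ∧
        closure V.1 ⊆ s.2.1 ∧ (∀ z ∈ s.1, |f z y - f z y'| ≤ 1 / ((n : ℝ) + 1)) ∧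
        ∀ z ∈ V.1, ε / 4 < |f z y - f z y'| := by
    rintro n ⟨F, U, hU, hne⟩
    obtain ⟨y, y', hF, x, hxU, hx⟩ := exists_pair_of_forall_lt_abs_sub hfX hfK hε H
      (Nat.one_div_pos_of_nat (α := ℝ) (n := n)) F hU hne
    have hW : IsOpen (U ∩ {z | ε / 4 < |f z y - f z y'|}) :=
      hU.inter (isOpen_lt continuous_const ((hfX y).sub (hfX y')).abs)
    obtain ⟨C, hC, hCc, hCW⟩ := exists_mem_nhds_isClosed_subset (hW.mem_nhds ⟨hxU, hx⟩)
    have hxC : x ∈ interior C := mem_interior_iff_mem_nhds.2 hC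
    exact ⟨x, ⟨interior C, isOpen_interior, x, hxC⟩, y, y', hxC,
      (closure_minimal interior_subset hCc).trans (hCW.trans inter_subset_left), hF,
      fun z hz => (hCW (interior_subset hz)).2⟩
  choose p V q q' hpV hVs hq hqV using step
  classical
  obtain ⟨C, hC, hCn⟩ := exists_compact_mem_nhds (Classical.arbitrary X)
  let s : ℕ → Finset X × {U : Set X // IsOpen U ∧ U.Nonempty} := fun n =>
    Nat.rec (∅, ⟨interior C, isOpen_interior, _, mem_interior_iff_mem_nhds.2 hCn⟩)
      (fun n s => (insert (p n s) s.1, V n s)) n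
  have hFmono : Monotone fun n => (s n).1 :=
    monotone_nat_of_le_succ fun n => Finset.subset_insert _ _
  have hUanti : Antitone fun n => (s n).2.1 :=
    antitone_nat_of_succ_le fun n => subset_closure.trans (hVs n (s n))
  have hmem : ∀ k n, k ≤ n → p n (s n) ∈ (s (k + 1)).2.1 := fun k n hkn =>
    hUanti (Nat.succ_le_succ hkn) (hpV n (s n))
  obtain ⟨x, -, hx⟩ := hC.exists_mapClusterPt (f := atTop) (u := fun n => p n (s n))
    (tendsto_principal.2 (Eventually.of_forall fun n =>
      interior_subset (hVs 0 (s 0) (subset_closure (hmem 0 n (Nat.zero_le n))))))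
  obtain ⟨⟨y, y'⟩, hy⟩ := exists_clusterPt_of_compactSpace
    (map (fun n => (q n (s n), q' n (s n))) atTop)
  -- The points eventually stay in the next open set, whose closure lies inside `V n (s n)`.
  have hxV : ∀ n, x ∈ (V n (s n)).1 := fun n =>
    hVs (n + 1) (s (n + 1)) (isClosed_closure.mem_of_mapClusterPt hx
      (eventually_atTop.2 ⟨n + 1, fun m hm => subset_closure (hmem (n + 1) m hm)⟩))
  have hcont : ∀ z, Continuous fun w : K × K => |f z w.1 - f z w.2| := fun z =>
    (((hfK z).comp continuous_fst).sub ((hfK z).comp continuous_snd)).abs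
  have heq : ∀ n, |f (p n (s n)) y - f (p n (s n)) y'| ≤ 0 := by
    intro n
    refine le_of_forall_pos_le_add fun δ hδ => ?_
    obtain ⟨m, hm⟩ := exists_nat_one_div_lt hδ
    rw [zero_add]
    refine (isClosed_le (hcont (p n (s n))) continuous_const).mem_of_mapClusterPt hy
      (eventually_atTop.2 ⟨max m (n + 1), fun k hk => ?_⟩)
    refine (hq k (s k) _ (hFmono (le_of_max_le_right hk) (Finset.mem_insert_self _ _))).trans
      (le_trans ?_ hm.le)
    exact Nat.one_div_le_one_div (le_of_max_le_left hk)
  -- The two iterated limits disagree: points first gives gap `0`, pairs first gives gap at least `ε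
  -- / 4`.
  have h₀ : |f x y - f x y'| ≤ 0 :=
    (isClosed_le ((hfX y).sub (hfX y')).abs continuous_const).mem_of_mapClusterPt hx
      (Eventually.of_forall heq)
  have h₁ : ε / 4 ≤ |f x y - f x y'| :=
    (isClosed_le continuous_const (hcont x)).mem_of_mapClusterPt hy
      (Eventually.of_forall fun n => (hqV n (s n) x (hxV n)).le)
  linarith

end SeparateContinuity

/-! ### Ellis' theorem -/

section Ellis

open Filter Set

variable {G : Type*} [Group G] [TopologicalSpace G] [T2Space G] [LocallyCompactSpace G]
  [SeparatelyContinuousMul G]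

/-- On a locally compact Hausdorff semitopological group, continuous functions with compact
support are uniformly continuous. -/
theorem HasCompactSupport.eventually_forall_abs_mul_sub_le {h : G → ℝ} (hc : Continuous h)
    (hs : HasCompactSupport h) {ε : ℝ} (hε : 0 < ε) :
    ∀ᶠ x in 𝓝 (1 : G), ∀ y, |h (x * y) - h y| ≤ ε := by
  -- Compact support allows extension by zero to the one-point compactification, which supplies the
  -- compact factor.
  let f : G → OnePoint G → ℝ := fun x o => o.elim 0 fun y => h (x * y)
  have hfG : ∀ y, Continuous fun x => f x y := by
    intro y
    induction y using OnePoint.rec with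
    | infty => exact continuous_const
    | coe y => exact hc.comp (continuous_mul_const y)
  have hfK : ∀ x, Continuous (f x) := by
    intro x
    refine (OnePoint.continuous_iff _).2 ⟨?_, hc.comp (continuous_const_mul x)⟩
    have : HasCompactSupport fun y => h (x * y) := hs.comp_homeomorph (Homeomorph.mulLeft x)
    exact tendsto_const_nhds.congr' (hasCompactSupport_iff_eventuallyEq.1 this).symm
  obtain ⟨U, hU, ⟨u, hu⟩, hUf⟩ := exists_isOpen_forall_abs_sub_le hfG hfK hε
  have hmem : (fun x => x * u) ⁻¹' U ∈ 𝓝 (1 : G) :=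
    (hU.preimage (continuous_mul_const u)).mem_nhds (by simpa using hu)
  filter_upwards [hmem] with x hx y
  -- The strip around `u` is moved to `1` by evaluating at `u⁻¹ * y`.
  simpa [f, mul_assoc] using hUf (x * u) hx u hu ((u⁻¹ * y : G) : OnePoint G)

/-- **Ellis' theorem**: a locally compact Hausdorff semitopological group is a topological
group. -/
theorem IsTopologicalGroup.of_separatelyContinuousMul : IsTopologicalGroup G := by
  have key : ∀ N ∈ 𝓝 (1 : G), ∃ h : G → ℝ, Continuous h ∧ h 1 = 1 ∧ (∀ x, 0 < h x → x ∈ N) ∧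
      ∀ᶠ x in 𝓝 (1 : G), ∀ y, |h (x * y) - h y| ≤ 1 / 3 := by
    intro N hN
    obtain ⟨h, h₁, h₀, hs, -⟩ := exists_continuous_one_zero_of_isCompact
      (isCompact_singleton (x := (1 : G))) (isOpen_interior (s := N)).isClosed_compl
      (disjoint_singleton_left.2 fun h => h (mem_interior_iff_mem_nhds.2 hN))
    refine ⟨h, h.continuous, h₁ rfl, fun x hx => ?_,
      hs.eventually_forall_abs_mul_sub_le h.continuous (by norm_num)⟩
    by_contra hxN
    exact hx.ne' (h₀ fun hx' => hxN (interior_subset hx'))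
  refine IsTopologicalGroup.of_nhds_one' ?_ ?_
    (fun x => ?_) (fun x => ?_)
  · intro N hN
    obtain ⟨h, hc, h₁, hpos, hu⟩ := key N hN
    have hy : ∀ᶠ y in 𝓝 (1 : G), 2 / 3 < h y :=
      hc.continuousAt.eventually_const_lt (by rw [h₁]; norm_num)
    rw [mem_map]
    -- `h (xy) ≥ h y - 1/3 > 1/3`, so `xy` lies in `N`.
    filter_upwards [hu.prod_mk hy] with w hw
    have := (abs_le.1 (hw.1 w.2)).1
    exact hpos _ (by simp only [Function.uncurry]; linarith [hw.2])
  · intro N hN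
    obtain ⟨h, hc, h₁, hpos, hu⟩ := key N hN
    rw [mem_map]
    filter_upwards [hu] with x hx
    -- At `y = x⁻¹` this reads `1 - h x⁻¹ ≤ 1/3`.
    have := (abs_le.1 (hx x⁻¹)).2
    rw [mul_inv_cancel, h₁] at this
    exact hpos _ (by linarith)
  · simpa using ((Homeomorph.mulLeft x).map_nhds_eq 1).symm
  · simpa using ((Homeomorph.mulRight x).map_nhds_eq 1).symm

end Ellis

/-! ### Chains of idempotents of type `ω` -/

/-- An injective map that is multiplicative on a chain of idempotents of order type `ω` (reversed)
and maps this chain to itself acts on the indices by a strictly monotone map. -/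
theorem strictMono_of_map_chain {S : Type u} [Mul S] {e : ℕ → S}
    (he : ∀ m n, m ≤ n ↔ e m * e n = e n) {f : S → S}
    (hmul : ∀ m n, f (e m) * f (e n) = f (e m * e n)) (hinj : ∀ m n, f (e m) = f (e n) → e m = e n)
    {φ : ℕ → ℕ} (hφ : ∀ n, e (φ n) = f (e n)) : StrictMono φ := by
  have hmono : Monotone φ := fun m n hmn => by
    rw [he, hφ, hφ, hmul, (he m n).1 hmn]
  refine hmono.strictMono_of_injective fun m n hmn => ?_
  have hemn : e m = e n := hinj m n (by rw [← hφ, ← hφ, hmn])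
  exact le_antisymm ((he m n).2 (hemn ▸ (he n n).1 le_rfl)) ((he n m).2 (hemn ▸ (he m m).1 le_rfl))

/-- In a monoid with zero, `a` and `b` with `ab = 1` *generate the idempotents* if `b ^ n * a ^ n`
are pairwise distinct and exhaust the nonzero idempotents. -/
structure GeneratesIdempotents {M : Type u} [MonoidWithZero M] (a b : M) : Prop where
  mul_eq_one : a * b = 1
  one_ne_zero : (1 : M) ≠ 0
  injective : Function.Injective fun n : ℕ => b ^ n * a ^ n
  exists_eq : ∀ x : M, IsIdempotentElem x → x ≠ 0 → ∃ n : ℕ, b ^ n * a ^ n = x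

section PowLemmas

variable {M : Type u} [Monoid M] {a b : M}

theorem pow_mul_pow_eq_one_of_mul_eq_one (h : a * b = 1) (n : ℕ) : a ^ n * b ^ n = 1 := by
  induction n with
  | zero => simp
  | succ n ih => rw [pow_succ, pow_succ', mul_assoc, ← mul_assoc a b, h, one_mul, ih]

theorem pow_mul_pow_of_mul_eq_one_of_le (h : a * b = 1) {m n : ℕ} (hmn : m ≤ n) :
    a ^ m * b ^ n = b ^ (n - m) := by
  obtain ⟨k, rfl⟩ := Nat.exists_eq_add_of_le hmn
  rw [pow_add, ← mul_assoc, pow_mul_pow_eq_one_of_mul_eq_one h, one_mul, Nat.add_sub_cancel_left]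

theorem pow_mul_pow_of_mul_eq_one_of_ge (h : a * b = 1) {m n : ℕ} (hmn : m ≤ n) :
    a ^ n * b ^ m = a ^ (n - m) := by
  obtain ⟨k, rfl⟩ := Nat.exists_eq_add_of_le' hmn
  rw [pow_add, mul_assoc, pow_mul_pow_eq_one_of_mul_eq_one h, mul_one, Nat.add_sub_cancel]

theorem isIdempotentElem_pow_mul_pow (h : a * b = 1) (n : ℕ) :
    IsIdempotentElem (b ^ n * a ^ n) := by
  rw [IsIdempotentElem, mul_assoc, ← mul_assoc (a ^ n), pow_mul_pow_eq_one_of_mul_eq_one h, one_mul]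

theorem pow_mul_pow_mul_of_le (h : a * b = 1) {m n : ℕ} (hmn : m ≤ n) :
    b ^ m * a ^ m * (b ^ n * a ^ n) = b ^ n * a ^ n := by
  rw [mul_assoc, ← mul_assoc (a ^ m), pow_mul_pow_of_mul_eq_one_of_le h hmn, ← mul_assoc, ← pow_add,
    Nat.add_sub_cancel' hmn]

theorem pow_mul_pow_mul_of_ge (h : a * b = 1) {m n : ℕ} (hmn : m ≤ n) :
    b ^ n * a ^ n * (b ^ m * a ^ m) = b ^ n * a ^ n := by
  rw [mul_assoc, ← mul_assoc (a ^ n), pow_mul_pow_of_mul_eq_one_of_ge h hmn, ← pow_add,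
    Nat.sub_add_cancel hmn]

end PowLemmas

/-! ### Normal form `b ^ i * g * a ^ j` -/

namespace GeneratesIdempotents

variable {M : Type u} [MonoidWithZero M] {a b : M}

theorem pow_mul_pow_ne_zero (h : GeneratesIdempotents a b) (n : ℕ) : b ^ n * a ^ n ≠ 0 := fun hn => h.one_ne_zero <| by
  have := congrArg (fun x => a ^ n * x * b ^ n) hn
  simpa [← mul_assoc, pow_mul_pow_eq_one_of_mul_eq_one h.mul_eq_one] using this

theorem le_of_mul_eq (h : GeneratesIdempotents a b) {m n : ℕ}
    (hmn : b ^ m * a ^ m * (b ^ n * a ^ n) = b ^ n * a ^ n) :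
    m ≤ n := by
  by_contra hlt
  rw [pow_mul_pow_mul_of_ge h.mul_eq_one (not_le.1 hlt).le] at hmn
  exact hlt (h.injective hmn).le

theorem le_iff (h : GeneratesIdempotents a b) (m n : ℕ) :
    m ≤ n ↔ b ^ m * a ^ m * (b ^ n * a ^ n) = b ^ n * a ^ n :=
  ⟨pow_mul_pow_mul_of_le h.mul_eq_one, h.le_of_mul_eq⟩

/-- Conjugation acts on the indices by a strictly monotone surjection of `ℕ`, and the identity is
the only one. -/
theorem unit_mul_mul_inv (h : GeneratesIdempotents a b) (u : Mˣ) (n : ℕ) :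
    u * (b ^ n * a ^ n) * (u⁻¹ : Mˣ) = b ^ n * a ^ n := by
  have hconj : ∀ (v : Mˣ) (n : ℕ), ∃ m, b ^ m * a ^ m = v * (b ^ n * a ^ n) * (v⁻¹ : Mˣ) := by
    intro v n
    refine h.exists_eq _ ?_ ?_
    · have hn := isIdempotentElem_pow_mul_pow h.mul_eq_one n
      generalize b ^ n * a ^ n = e at hn
      rw [IsIdempotentElem]
      conv_rhs => rw [← hn.eq]
      simp only [mul_assoc, Units.inv_mul_cancel_left]
    · rw [Ne, Units.mul_left_eq_zero, Units.mul_right_eq_zero]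
      exact h.pow_mul_pow_ne_zero n
  choose φ hφ using hconj u
  have hmono : StrictMono φ := by
    refine strictMono_of_map_chain h.le_iff (f := fun x => u * x * (u⁻¹ : Mˣ)) (fun m n => ?_)
      (fun m n hmn => by simpa using hmn) hφ
    simp only [mul_assoc, Units.inv_mul_cancel_left]
  have hrange : Set.range φ = Set.range (id : ℕ → ℕ) := by
    rw [Set.range_id, Set.range_eq_univ]
    intro n
    obtain ⟨m, hm⟩ := hconj u⁻¹ n
    refine ⟨m, h.injective ?_⟩
    change b ^ φ m * a ^ φ m = b ^ n * a ^ n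
    rw [hφ, hm]
    simp [mul_assoc]
  have := (hmono.range_inj strictMono_id).1 hrange
  rw [← hφ, this, id]

theorem mul_comm_of_isUnit (h : GeneratesIdempotents a b) {u : M} (hu : IsUnit u) :
    u * (b * a) = b * a * u := by
  obtain ⟨u, rfl⟩ := hu
  have := h.unit_mul_mul_inv u 1
  rwa [pow_one, pow_one, Units.mul_inv_eq_iff_eq_mul] at this

/-- The inner `ba` commutes past `u`, and `aba = a` absorbs it. -/
theorem mul_mul_mul (h : GeneratesIdempotents a b) {u : M} (hu : IsUnit u) (v : M) :
    a * u * b * (a * v * b) = a * (u * v) * b := by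
  calc a * u * b * (a * v * b) = a * (u * (b * a)) * (v * b) := by simp only [mul_assoc]
    _ = a * b * a * u * (v * b) := by rw [h.mul_comm_of_isUnit hu]; simp only [mul_assoc]
    _ = a * (u * v) * b := by rw [h.mul_eq_one, one_mul]; simp only [mul_assoc]

/-- The endomorphism `u ↦ aub` of the group of units. -/
def unitsEnd (h : GeneratesIdempotents a b) : IsUnit.submonoid M →* IsUnit.submonoid M where
  toFun u := ⟨a * u * b, by
    obtain ⟨u, hu⟩ := u
    obtain ⟨u, rfl⟩ := hu
    refine ⟨⟨a * u * b, a * (u⁻¹ : Mˣ) * b, ?_, ?_⟩, rfl⟩ <;>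
    · rw [h.mul_mul_mul (Units.isUnit _)]
      simp [h.mul_eq_one]⟩
  map_one' := Subtype.ext (by simp [h.mul_eq_one])
  map_mul' u v := Subtype.ext (h.mul_mul_mul u.2 v).symm

theorem mul_unit_eq (h : GeneratesIdempotents a b) (u : IsUnit.submonoid M) :
    a * (u : M) = h.unitsEnd u * a := by
  change a * (u : M) = a * u * b * a
  rw [mul_assoc (a * (u : M)), mul_assoc a, h.mul_comm_of_isUnit u.2, ← mul_assoc, ← mul_assoc,
    h.mul_eq_one, one_mul]

theorem unit_mul_eq (h : GeneratesIdempotents a b) (u : IsUnit.submonoid M) :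
    (u : M) * b = b * h.unitsEnd u := by
  change (u : M) * b = b * (a * u * b)
  rw [← mul_assoc, ← mul_assoc, ← h.mul_comm_of_isUnit u.2, mul_assoc, mul_assoc, h.mul_eq_one,
    mul_one]

theorem pow_mul_unit_eq (h : GeneratesIdempotents a b) (n : ℕ) (u : IsUnit.submonoid M) :
    a ^ n * (u : M) = (h.unitsEnd^[n] u : IsUnit.submonoid M) * a ^ n := by
  induction n with
  | zero => simp
  | succ n ih =>
    rw [pow_succ', mul_assoc, ih, ← mul_assoc, h.mul_unit_eq, Function.iterate_succ_apply',
      mul_assoc]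

theorem unit_mul_pow_eq (h : GeneratesIdempotents a b) (n : ℕ) (u : IsUnit.submonoid M) :
    (u : M) * b ^ n = b ^ n * (h.unitsEnd^[n] u : IsUnit.submonoid M) := by
  induction n with
  | zero => simp
  | succ n ih =>
    rw [pow_succ, ← mul_assoc, ih, mul_assoc, h.unit_mul_eq, Function.iterate_succ_apply',
      mul_assoc]

/-- The map `(i, g, j) ↦ b ^ i * g * a ^ j`, which sends the adjoined zero to zero. -/
def ofBruckReilly (h : GeneratesIdempotents a b) : WithZero (BruckReilly h.unitsEnd) → M :=
  WithZero.recZeroCoe 0 fun x => b ^ x.fst * (x.mid : M) * a ^ x.snd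

@[simp]
theorem ofBruckReilly_zero (h : GeneratesIdempotents a b) : h.ofBruckReilly 0 = 0 := rfl

@[simp]
theorem ofBruckReilly_coe (h : GeneratesIdempotents a b) (x : BruckReilly h.unitsEnd) :
    h.ofBruckReilly x = b ^ x.fst * (x.mid : M) * a ^ x.snd := rfl

theorem ofBruckReilly_mul (h : GeneratesIdempotents a b)
    (x y : WithZero (BruckReilly h.unitsEnd)) :
    h.ofBruckReilly (x * y) = h.ofBruckReilly x * h.ofBruckReilly y := by
  induction x with
  | zero => simp
  | coe x =>
    induction y with
    | zero => simp
    | coe y =>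
      obtain ⟨i, s, j⟩ := x
      obtain ⟨m, t, n⟩ := y
      rw [← WithZero.coe_mul, BruckReilly.mul_def]
      simp only [ofBruckReilly_coe, Submonoid.coe_mul]
      -- The middle `a ^ j * b ^ m` collapses to a power of `b` or of `a`, and moving that power
      -- past a unit applies `θ` as often as its exponent.
      rcases le_total j m with hjm | hmj
      · rw [min_eq_left hjm, Nat.sub_self, Function.iterate_zero, id, Nat.add_sub_cancel_left,
          Nat.add_sub_assoc hjm]
        calc _ = b ^ i * (b ^ (m - j) * (h.unitsEnd^[m - j] s : IsUnit.submonoid M)) * t * a ^ n := by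
              simp only [pow_add, mul_assoc]
          _ = b ^ i * s * (a ^ j * b ^ m) * t * a ^ n := by
              rw [← h.unit_mul_pow_eq, pow_mul_pow_of_mul_eq_one_of_le h.mul_eq_one hjm]
              simp only [mul_assoc]
          _ = _ := by simp only [mul_assoc]
      · rw [min_eq_right hmj, Nat.sub_self, Function.iterate_zero, id, Nat.add_sub_cancel,
          Nat.sub_add_comm hmj]
        calc _ = b ^ i * s * ((h.unitsEnd^[j - m] t : IsUnit.submonoid M) * a ^ (j - m)) * a ^ n := by
              simp only [pow_add, mul_assoc]
          _ = b ^ i * s * (a ^ j * b ^ m) * t * a ^ n := by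
              rw [← h.pow_mul_unit_eq, pow_mul_pow_of_mul_eq_one_of_ge h.mul_eq_one hmj]
              simp only [mul_assoc]
          _ = _ := by simp only [mul_assoc]

theorem ofBruckReilly_mul_inv (h : GeneratesIdempotents a b) (i j : ℕ) (s : IsUnit.submonoid M) :
    h.ofBruckReilly (⟨i, s, j⟩ : BruckReilly h.unitsEnd) *
      h.ofBruckReilly (⟨j, s⁻¹, i⟩ : BruckReilly h.unitsEnd) = b ^ i * a ^ i := by
  rw [← h.ofBruckReilly_mul, ← WithZero.coe_mul, BruckReilly.mul_def]
  simp

theorem ofBruckReilly_ne_zero (h : GeneratesIdempotents a b) (x : BruckReilly h.unitsEnd) :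
    h.ofBruckReilly x ≠ 0 := fun hx => by
  have := h.ofBruckReilly_mul_inv x.fst x.snd x.mid
  rw [show (⟨x.fst, x.mid, x.snd⟩ : BruckReilly h.unitsEnd) = x from rfl, hx, zero_mul] at this
  exact h.pow_mul_pow_ne_zero _ this.symm

/-- The inverse of `b ^ i * s * a ^ j` is `b ^ j * s⁻¹ * a ^ i`. By uniqueness of inverses, equal
images have equal `xx⁻¹` and `x⁻¹x`, which recover `i` and `j`; then `a ^ i` and `b ^ j` strip off
the outer powers. -/
theorem ofBruckReilly_injective (h : GeneratesIdempotents a b) (hM : IsInverseSemigroup M) :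
    Function.Injective h.ofBruckReilly := by
  intro x y hxy
  induction x with
  | zero =>
    induction y with
    | zero => rfl
    | coe y => exact absurd hxy.symm (h.ofBruckReilly_ne_zero y)
  | coe x =>
    induction y with
    | zero => exact absurd hxy (h.ofBruckReilly_ne_zero x)
    | coe y =>
      obtain ⟨i, s, j⟩ := x
      obtain ⟨m, t, n⟩ := y
      have hregular : ∀ (i j : ℕ) (s : IsUnit.submonoid M),
          h.ofBruckReilly (⟨i, s, j⟩ : BruckReilly h.unitsEnd) *
            h.ofBruckReilly (⟨j, s⁻¹, i⟩ : BruckReilly h.unitsEnd) *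
            h.ofBruckReilly (⟨i, s, j⟩ : BruckReilly h.unitsEnd) =
          h.ofBruckReilly (⟨i, s, j⟩ : BruckReilly h.unitsEnd) := by
        intro i j s
        simp only [← h.ofBruckReilly_mul, ← WithZero.coe_mul, BruckReilly.mul_def]
        simp
      have hinv : h.ofBruckReilly (⟨j, s⁻¹, i⟩ : BruckReilly h.unitsEnd) =
          h.ofBruckReilly (⟨n, t⁻¹, m⟩ : BruckReilly h.unitsEnd) := by
        refine (hM (h.ofBruckReilly (⟨i, s, j⟩ : BruckReilly h.unitsEnd))).unique
          ⟨hregular i j s, ?_⟩ ?_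
        · simpa using hregular j i s⁻¹
        · rw [hxy]
          exact ⟨hregular m n t, by simpa using hregular n m t⁻¹⟩
      have him : i = m := h.injective <| by
        simpa only [h.ofBruckReilly_mul_inv] using congrArg₂ (· * ·) hxy hinv
      have hjn : j = n := h.injective <| by
        have := congrArg₂ (· * ·) hinv hxy
        have h₁ := h.ofBruckReilly_mul_inv j i s⁻¹
        have h₂ := h.ofBruckReilly_mul_inv n m t⁻¹
        rw [inv_inv] at h₁ h₂
        simpa only [h₁, h₂] using this
      subst him hjn
      have hst := congrArg (fun z => a ^ i * z * b ^ j) hxy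
      have hpow := pow_mul_pow_eq_one_of_mul_eq_one h.mul_eq_one
      simp only [ofBruckReilly_coe, mul_assoc, hpow, mul_one] at hst
      rw [← mul_assoc, ← mul_assoc, hpow, one_mul, one_mul] at hst
      rw [Subtype.ext hst]

/-- If `xx⁻¹ = b ^ i * a ^ i` and `x⁻¹x = b ^ j * a ^ j`, then `a ^ i * x * b ^ j` is a unit with
inverse `a ^ j * x⁻¹ * b ^ i`. -/
theorem ofBruckReilly_surjective (h : GeneratesIdempotents a b) (hM : IsInverseSemigroup M) :
    Function.Surjective h.ofBruckReilly := by
  intro x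
  by_cases hx : x = 0
  · exact ⟨0, hx.symm⟩
  obtain ⟨y, ⟨hxyx, hyxy⟩, -⟩ := hM x
  obtain ⟨i, hi⟩ := h.exists_eq (x * y) (by rw [IsIdempotentElem, ← mul_assoc, hxyx])
    fun h0 => hx (by rw [← hxyx, h0, zero_mul])
  obtain ⟨j, hj⟩ := h.exists_eq (y * x) (by rw [IsIdempotentElem, ← mul_assoc, hyxy])
    fun h0 => hx (by rw [← hxyx, mul_assoc, h0, mul_zero])
  have hpow := pow_mul_pow_eq_one_of_mul_eq_one h.mul_eq_one
  have hu : IsUnit (a ^ i * x * b ^ j) := by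
    refine ⟨⟨a ^ i * x * b ^ j, a ^ j * y * b ^ i, ?_, ?_⟩, rfl⟩
    · calc _ = a ^ i * (x * (b ^ j * a ^ j) * y) * b ^ i := by simp only [mul_assoc]
        _ = a ^ i * (b ^ i * a ^ i) * b ^ i := by rw [hj, ← mul_assoc x, hxyx, hi]
        _ = (a ^ i * b ^ i) * (a ^ i * b ^ i) := by simp only [mul_assoc]
        _ = 1 := by rw [hpow, one_mul]
    · calc _ = a ^ j * (y * (b ^ i * a ^ i) * x) * b ^ j := by simp only [mul_assoc]
        _ = a ^ j * (b ^ j * a ^ j) * b ^ j := by rw [hi, ← mul_assoc y, hyxy, hj]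
        _ = (a ^ j * b ^ j) * (a ^ j * b ^ j) := by simp only [mul_assoc]
        _ = 1 := by rw [hpow, one_mul]
  refine ⟨((⟨i, ⟨_, hu⟩, j⟩ : BruckReilly h.unitsEnd) : WithZero _), ?_⟩
  calc _ = (b ^ i * a ^ i) * x * (b ^ j * a ^ j) := by simp only [ofBruckReilly_coe, mul_assoc]
    _ = x := by rw [hi, hj, hxyx, ← mul_assoc, hxyx]

/-- An inverse monoid with zero whose nonzero idempotents are generated by `a` and `b` is the
Bruck–Reilly extension of its group of units with adjoined zero. -/
noncomputable def mulEquivBruckReilly (h : GeneratesIdempotents a b) (hM : IsInverseSemigroup M) :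
    M ≃* WithZero (BruckReilly h.unitsEnd) :=
  (MulEquiv.ofBijective (⟨h.ofBruckReilly, h.ofBruckReilly_mul⟩ : _ →ₙ* M)
    ⟨h.ofBruckReilly_injective hM, h.ofBruckReilly_surjective hM⟩).symm

/-- Since `ba` fixes `b ^ i` on the left and `a ^ j` on the right for positive exponents, only `i =
j = 0` survives. In a Hausdorff space both conditions are open. -/
theorem isUnit_iff (h : GeneratesIdempotents a b) (hM : IsInverseSemigroup M) (x : M) :
    IsUnit x ↔ b * a * x ≠ x ∧ x * (b * a) ≠ x := by
  have hne : b * a ≠ 1 := fun hba => by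
    have : (1 : ℕ) = 0 := h.injective (by simpa using hba)
    omega
  constructor
  · intro hx
    exact ⟨fun hx' => hne (hx.mul_eq_right.1 hx'), fun hx' => hne (hx.mul_eq_left.1 hx')⟩
  · rintro ⟨hl, hr⟩
    have hx : x ≠ 0 := fun hx => hl (by rw [hx, mul_zero])
    obtain ⟨y, rfl⟩ := h.ofBruckReilly_surjective hM x
    induction y with
    | zero => exact absurd rfl hx
    | coe y =>
      obtain ⟨i, s, j⟩ := y
      rw [ofBruckReilly_coe] at hl hr ⊢
      have hi : i = 0 := by
        by_contra hi
        obtain ⟨k, rfl⟩ := Nat.exists_eq_succ_of_ne_zero hi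
        have : b * a * b ^ (k + 1) = b ^ (k + 1) := by
          rw [pow_succ', mul_assoc, ← mul_assoc a, h.mul_eq_one, one_mul]
        exact hl (by rw [← mul_assoc, ← mul_assoc, this])
      have hj : j = 0 := by
        by_contra hj
        obtain ⟨k, rfl⟩ := Nat.exists_eq_succ_of_ne_zero hj
        have : a ^ (k + 1) * (b * a) = a ^ (k + 1) := by
          rw [pow_succ, mul_assoc, ← mul_assoc a b, h.mul_eq_one, one_mul]
        exact hr (by rw [mul_assoc, this])
      subst hi hj
      rw [pow_zero, pow_zero, one_mul, mul_one]
      exact s.2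

end GeneratesIdempotents

/-! ### Transport of the topology -/

theorem GeneratesIdempotents.exists_bruckReilly {M : Type u} [MonoidWithZero M]
    [TopologicalSpace M] [T2Space M] [SeparatelyContinuousMul M] {a b : M}
    (h : GeneratesIdempotents a b) (hM : IsInverseSemigroup M) :
    ∃ (G : Type u) (_ : Group G) (_ : TopologicalSpace G) (θ : G →* G)
      (_ : TopologicalSpace (WithZero (BruckReilly θ))),
      IsTopologicalBruckReillyExtensionWithZero θ ∧
        Nonempty (M ≃ₜ* WithZero (BruckReilly θ)) ∧
          (LocallyCompactSpace M → LocallyCompactSpace G ∧ IsTopologicalGroup G) := by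
  let e := h.mulEquivBruckReilly hM
  let : TopologicalSpace (WithZero (BruckReilly h.unitsEnd)) := .induced e.symm inferInstance
  have he : IsInducing e.symm := ⟨rfl⟩
  let f : WithZero (BruckReilly h.unitsEnd) ≃ₜ M := e.symm.toEquiv.toHomeomorphOfIsInducing he
  have : SeparatelyContinuousMul (IsUnit.submonoid M) :=
    ⟨Continuous.subtype_mk ((continuous_const_mul _).comp continuous_subtype_val) _,
      Continuous.subtype_mk ((continuous_mul_const _).comp continuous_subtype_val) _⟩
  -- The submonoid replaces `Mˣ`, whose topology also controls inverses and may be finer than the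
  -- subspace topology.
  refine ⟨IsUnit.submonoid M, inferInstance, inferInstance, h.unitsEnd, inferInstance, ?_,
    ⟨{ e with
        continuous_toFun := f.symm.continuous
        continuous_invFun := f.continuous }⟩, fun hlc => ?_⟩
  · refine ⟨inferInstance, inferInstance, f.symm.t2Space, ⟨?_, ?_⟩, 0, ?_⟩
    · intro x
      refine he.continuous_iff.2 ?_
      simp only [Function.comp_def, map_mul]
      exact (continuous_const_mul _).comp he.continuous
    · intro x
      refine he.continuous_iff.2 ?_
      simp only [Function.comp_def, map_mul]
      exact (continuous_mul_const _).comp he.continuous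
    · refine (f.isEmbedding.of_comp_iff).1 ?_
      convert IsEmbedding.subtypeVal (p := (· ∈ IsUnit.submonoid M)) using 1
      funext g
      change b ^ 0 * (g : M) * a ^ 0 = g
      simp
  · have hopen : IsOpen (IsUnit.submonoid M : Set M) := by
      have : (IsUnit.submonoid M : Set M) = {x | b * a * x = x}ᶜ ∩ {x | x * (b * a) = x}ᶜ :=
        Set.ext fun x => h.isUnit_iff hM x
      rw [this]
      exact (isClosed_eq (continuous_const_mul _) continuous_id).isOpen_compl.inter
        (isClosed_eq (continuous_mul_const _) continuous_id).isOpen_compl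
    have : LocallyCompactSpace (IsUnit.submonoid M) := hopen.locallyCompactSpace
    exact ⟨this, IsTopologicalGroup.of_separatelyContinuousMul⟩

/-! ### Generators from `0`-bisimplicity -/

theorem IsZeroBisimpleInverseOmegaSemigroup.exists_idempotent_chain {S : Type u}
    [SemigroupWithZero S] (hS : IsZeroBisimpleInverseOmegaSemigroup S) :
    ∃ e : ℕ → S, (∀ n, IsIdempotentElem (e n) ∧ e n ≠ 0) ∧
      (∀ x, IsIdempotentElem x → x ≠ 0 → ∃ n, e n = x) ∧
      (∀ m n, m ≤ n ↔ e m * e n = e n) ∧ ∀ m n, m ≤ n → e n * e m = e n := by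
  obtain ⟨r⟩ := hS.omega_chain
  have hr : ∀ m n, m ≤ n ↔ (r.symm n : S) * r.symm m = r.symm n ∧
      (r.symm m : S) * r.symm n = r.symm n := fun m n => r.symm.map_rel_iff.symm
  refine ⟨fun n => r.symm n, fun n => (r.symm n).2,
    fun x hx hx0 => ⟨r ⟨x, hx, hx0⟩, by simp⟩, fun m n => ⟨fun hmn => ((hr m n).1 hmn).2, ?_⟩,
    fun m n hmn => ((hr m n).1 hmn).1⟩
  intro hmn
  rcases le_total m n with hle | hle
  · exact hle
  · have := ((hr n m).1 hle).1
    exact (r.symm.injective (Subtype.ext (this.symm.trans hmn))).le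

theorem IsInverseSemigroup.mul_eq_self_of_chain {S : Type u} [SemigroupWithZero S]
    (hS : IsInverseSemigroup S) {e : ℕ → S}
    (hsurj : ∀ x, IsIdempotentElem x → x ≠ 0 → ∃ n, e n = x)
    (hle : ∀ m n, m ≤ n → e m * e n = e n) (hge : ∀ m n, m ≤ n → e n * e m = e n) (x : S) :
    e 0 * x = x ∧ x * e 0 = x := by
  by_cases hx : x = 0
  · rw [hx, mul_zero, zero_mul]
    exact ⟨rfl, rfl⟩
  obtain ⟨y, ⟨hxyx, hyxy⟩, -⟩ := hS x
  obtain ⟨i, hi⟩ := hsurj (x * y) (by rw [IsIdempotentElem, ← mul_assoc, hxyx])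
    fun h0 => hx (by rw [← hxyx, h0, zero_mul])
  obtain ⟨j, hj⟩ := hsurj (y * x) (by rw [IsIdempotentElem, ← mul_assoc, hyxy])
    fun h0 => hx (by rw [← hxyx, mul_assoc, h0, mul_zero])
  constructor
  · rw [← hxyx, ← hi, ← mul_assoc, hle 0 i (Nat.zero_le i)]
  · rw [← hxyx, mul_assoc x y x, ← hj, mul_assoc, hge 0 j (Nat.zero_le j)]

/-- A `b` with `1 𝓛 b 𝓡 e 1` has a left inverse `a`, and `x ↦ bxa` carries the whole chain onto its
part below `e 1`. -/
theorem IsZeroBisimpleInverseOmegaSemigroup.exists_generatesIdempotents {M : Type u}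
    [MonoidWithZero M] (hM : IsZeroBisimpleInverseOmegaSemigroup M) {e : ℕ → M}
    (hidem : ∀ n, IsIdempotentElem (e n) ∧ e n ≠ 0)
    (hsurj : ∀ x, IsIdempotentElem x → x ≠ 0 → ∃ n, e n = x)
    (hle : ∀ m n, m ≤ n ↔ e m * e n = e n) (hge : ∀ m n, m ≤ n → e n * e m = e n)
    (he0 : e 0 = 1) : ∃ a b : M, GeneratesIdempotents a b := by
  have hone : (1 : M) ≠ 0 := he0 ▸ (hidem 0).2
  have hinj : Function.Injective e := fun m n hmn =>
    le_antisymm ((hle m n).2 (hmn ▸ (hidem m).1)) ((hle n m).2 (hmn ▸ (hidem n).1))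
  have hD : GreenD (1 : M) (e 1) := by
    change e 1 ∈ {x | GreenD 1 x}
    rw [hM.greenD_class_of_ne_zero 1 hone]
    exact (hidem 1).2
  obtain ⟨b, hL, hR⟩ := hD
  have h₁ : (1 : M) ∈ principalLeftIdeal b := hL ▸ Set.mem_insert _ _
  obtain ⟨a, hab⟩ : ∃ a, a * b = 1 := by
    rcases h₁ with h₁ | ⟨a, ha⟩
    · exact ⟨1, by rw [← h₁, one_mul]⟩
    · exact ⟨a, ha⟩
  have heb : e 1 * b = b := by
    have : b ∈ principalRightIdeal (e 1) := hR ▸ Set.mem_insert _ _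
    rcases this with hb | ⟨v, rfl⟩
    · rw [hb, (hidem 1).1.eq]
    · change e 1 * (e 1 * v) = e 1 * v
      rw [← mul_assoc, (hidem 1).1.eq]
  obtain ⟨w, hw⟩ : ∃ w, b * w = e 1 := by
    have : e 1 ∈ principalRightIdeal b := hR ▸ Set.mem_insert _ _
    rcases this with hb | ⟨w, hw⟩
    · exact ⟨1, by rw [← hb, mul_one]⟩
    · exact ⟨w, hw⟩
  -- Here `bw = e 1` gives `e 1 ≤ ba`, while `e 1 * b = b` gives `ba ≤ e 1`.
  have hba : b * a = e 1 := by
    have hbae : b * a * e 1 = e 1 := by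
      rw [← hw, mul_assoc, ← mul_assoc a, hab, one_mul]
    obtain ⟨k, hk⟩ := hsurj (b * a)
      (by rw [IsIdempotentElem, mul_assoc, ← mul_assoc a, hab, one_mul])
      fun h0 => (hidem 1).2 (by rw [← hbae, h0, zero_mul])
    have hk1 : k ≤ 1 := (hle k 1).2 (by rw [hk, hbae])
    rw [← hge k 1 hk1, hk, ← mul_assoc, heb]
  have hcancel : ∀ x y, b * x * a = b * y * a → x = y := fun x y hxy => by
    have hz : ∀ z, a * (b * z * a) * b = z := fun z => by
      calc a * (b * z * a) * b = (a * b) * z * (a * b) := by simp only [mul_assoc]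
        _ = z := by rw [hab, one_mul, mul_one]
    rw [← hz x, hxy, hz]
  have hshift : ∀ n, ∃ m, e m = b * e n * a := fun n => by
    refine hsurj _ ?_ fun h0 => (hidem n).2 (hcancel _ _ (by rw [h0, mul_zero, zero_mul]))
    calc b * e n * a * (b * e n * a) = b * e n * (a * b) * e n * a := by simp only [mul_assoc]
      _ = b * (e n * e n) * a := by rw [hab, mul_one, mul_assoc b]
      _ = b * e n * a := by rw [(hidem n).1.eq]
  choose φ hφ using hshift
  have hmono : StrictMono φ := by
    refine strictMono_of_map_chain hle (f := fun x => b * x * a) (fun m n => ?_)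
      (fun m n => hcancel _ _) hφ
    calc b * e m * a * (b * e n * a) = b * e m * (a * b) * e n * a := by simp only [mul_assoc]
      _ = b * (e m * e n) * a := by rw [hab, mul_one, mul_assoc b]
  have hφ0 : φ 0 = 1 := hinj (by rw [hφ, he0, mul_one, hba])
  have hrange : Set.range φ = Set.range Nat.succ := by
    ext k
    constructor
    · rintro ⟨n, rfl⟩
      have := hmono.monotone (Nat.zero_le n)
      exact ⟨φ n - 1, by omega⟩
    · rintro ⟨k, rfl⟩
      -- The preimage of `e (k + 1)` under the shift is `a * e (k + 1) * b`, as `ba = e 1` acts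
      -- trivially below `e 1`.
      have hk : b * (a * e (k + 1) * b) * a = e (k + 1) := by
        calc _ = b * a * e (k + 1) * (b * a) := by simp only [mul_assoc]
          _ = e (k + 1) := by
            rw [hba, (hle 1 (k + 1)).1 (by omega), hge 1 (k + 1) (by omega)]
      obtain ⟨m, hm⟩ := hsurj (a * e (k + 1) * b) (by
          refine hcancel _ _ ?_
          calc _ = b * (a * e (k + 1) * b) * (a * e (k + 1) * b) * a := by simp only [mul_assoc]
            _ = b * (a * (e (k + 1) * (b * a * e (k + 1))) * b) * a := by simp only [mul_assoc]
            _ = _ := by rw [hba, (hle 1 (k + 1)).1 (by omega), (hidem _).1.eq])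
        fun h0 => (hidem (k + 1)).2 (by rw [← hk, h0, mul_zero, zero_mul])
      exact ⟨m, hinj (by rw [hφ, hm, hk])⟩
  have hsucc : φ = Nat.succ := (hmono.range_inj fun m n => Nat.succ_lt_succ).1 hrange
  have hpow : ∀ n, b ^ n * a ^ n = e n := by
    intro n
    induction n with
    | zero => rw [pow_zero, pow_zero, one_mul, he0]
    | succ n ih =>
      rw [pow_succ', pow_succ, mul_assoc, ← mul_assoc _ _ a, ih, ← mul_assoc, ← hφ, hsucc]
  exact ⟨a, b, hab, hone, by simpa only [hpow] using hinj, by simpa only [hpow] using hsurj⟩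

theorem theorem2p7 (S : Type u) [SemigroupWithZero S] [TopologicalSpace S] [T2Space S]
    [SeparatelyContinuousMul S] (hS : IsZeroBisimpleInverseOmegaSemigroup S) :
    ∃ (G : Type u) (_ : Group G) (_ : TopologicalSpace G) (θ : G →* G)
      (_ : TopologicalSpace (WithZero (BruckReilly θ))),
      IsTopologicalBruckReillyExtensionWithZero θ ∧
        Nonempty (S ≃ₜ* WithZero (BruckReilly θ)) ∧
          (LocallyCompactSpace S → LocallyCompactSpace G ∧ IsTopologicalGroup G) := by
  obtain ⟨e, hidem, hsurj, hle, hge⟩ := hS.exists_idempotent_chain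
  have hone := hS.inverse.mul_eq_self_of_chain hsurj (fun m n => (hle m n).1) hge
  let : MonoidWithZero S :=
    { ‹SemigroupWithZero S› with
      one := e 0
      one_mul := fun x => (hone x).1
      mul_one := fun x => (hone x).2 }
  obtain ⟨a, b, h⟩ := IsZeroBisimpleInverseOmegaSemigroup.exists_generatesIdempotents (M := S) hS
    hidem hsurj hle hge rfl
  exact h.exists_bruckReilly hS.inverse
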